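/- Let $n\ge 1$ and let $\mathcal A_n=\{1<2<\cdots<n\}$. For a word $\mathbf w$ over $\mathcal A_n$, let $\mathrm P^{\sharp}(\mathbf w)$ be the labelled binary tree obtained by reading $\mathbf w$ from left to right and inserting its letters successively, as leaves, into an initially empty tree, where at a node labelled $x$ the letter $a$ goes to the left subtree if $a<x$ and to the right subtree otherwise; let $\mathrm P(\mathbf w)$ be the labelled binary tree obtained by reading $\mathbf w$ from right to left, where at a node labelled $x$ the letter $a$ goes to the right subtree if $a>x$ and to the left subtree otherwise. The Baxter monoid $\mathsf{baxt}_n$ of rank $n$ is the quotient of the free monoid $\mathcal A_n^{\star}$ by the congruence $\mathbf u\equiv\mathbf v \iff (\mathrm P^{\sharp}(\mathbf u),\mathrm P(\mathbf u))=(\mathrm P^{\sharp}(\mathbf v),\mathrm P(\mathbf v))$. Schützenberger's involution ${}^\sharp$ on $\mathsf{baxt}_n$ is the operation induced by $(w_1w_2\cdots w_k)^\sharp=w_k^\sharp\cdots w_2^\sharp w_1^\sharp$, where $i^\sharp=n+1-i$ for $i\in\mathcal A_n$; it satisfies $(x^\sharp)^\sharp=x$ and $(xy)^\sharp=y^\sharp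 x^\sharp$. An involution semigroup is a nonempty semigroup with a unary operation ${}^*$ satisfying $(x^*)^*=x$ and $(xy)^*=y^*x^*$. A variety of involution semigroups is a nonempty class of involution semigroups closed under involution subsemigroups, homomorphic images and arbitrary direct products (homomorphisms respect both operations), and the variety generated by an involution semigroup is the smallest variety containing it. **Theorem.** For all $m,n\ge 4$, the involution monoids $(\mathsf{baxt}_m,{}^\sharp)$ and $(\mathsf{baxt}_n,{}^\sharp)$ generate the same variety of involution semigroups. -/

import Mathlib

/-! ### Involution semigroups and varieties -/

/-- A (nonempty) involution semigroup: a semigroup with a unary operation `star` satisfying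
`star (star x) = x` and `star (x * y) = star y * star x`. -/
structure InvolutionSemigroup : Type 1 where
  carrier : Type
  [nonempty : Nonempty carrier]
  [semigroup : Semigroup carrier]
  [starMul : StarMul carrier]

namespace InvolutionSemigroup

attribute [instance] nonempty semigroup starMul

/-- `f` is a homomorphism of involution semigroups. -/
def IsHom (S T : InvolutionSemigroup) (f : S.carrier → T.carrier) : Prop :=
  (∀ x y, f (x * y) = f x * f y) ∧ ∀ x, f (star x) = star (f x)

/-- The direct product of a family of involution semigroups, with componentwise operations. -/
def prod {ι : Type} (S : ι → InvolutionSemigroup) : InvolutionSemigroup where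
  carrier := ∀ i, (S i).carrier

/-- A variety of involution semigroups: a nonempty class of involution semigroups that is closed
under subalgebras (up to isomorphism), homomorphic images and arbitrary direct products. -/
structure IsVariety (V : Set InvolutionSemigroup) : Prop where
  nonempty : V.Nonempty
  of_injective : ∀ S ∈ V, ∀ (T : InvolutionSemigroup) (f : T.carrier → S.carrier),
    IsHom T S f → Function.Injective f → T ∈ V
  of_surjective : ∀ S ∈ V, ∀ (T : InvolutionSemigroup) (f : S.carrier → T.carrier),
    IsHom S T f → Function.Surjective f → T ∈ V
  prod_mem : ∀ (ι : Type) (S : ι → InvolutionSemigroup), (∀ i, S i ∈ V) → prod S ∈ V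

/-- The variety generated by an involution semigroup: the smallest variety containing it. -/
def var (S : InvolutionSemigroup) : Set InvolutionSemigroup :=
  ⋂₀ {V | IsVariety V ∧ S ∈ V}

end InvolutionSemigroup

/-! ### The Baxter monoid of rank `n` with Schützenberger's involution -/

namespace Baxter

open BinaryTree

/-- Insertion into a right strict binary search tree (labels of the left subtree are `≤` the label
of the root, labels of the right subtree are `>` the label of the root). -/
def insertRight {α : Type} [LinearOrder α] (a : α) : BinaryTree α → BinaryTree α
  | nil => node a nil nil
  | node x l r => if x < a then node x l (insertRight a r) else node x (insertRight a l) r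

/-- Insertion into a left strict binary search tree (labels of the left subtree are `<` the label
of the root, labels of the right subtree are `≥` the label of the root). -/
def insertLeft {α : Type} [LinearOrder α] (a : α) : BinaryTree α → BinaryTree α
  | nil => node a nil nil
  | node x l r => if a < x then node x (insertLeft a l) r else node x l (insertLeft a r)

/-- The right strict binary search tree of a word, which is read from right to left. -/
def sylvTree {α : Type} [LinearOrder α] (w : List α) : BinaryTree α :=
  w.foldr insertRight nil

/-- The left strict binary search tree of a word, which is read from left to right. -/
def sylvSharpTree {α : Type} [LinearOrder α] (w : List α) : BinaryTree α :=
  w.foldl (fun T a => insertLeft a T) nil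

/-- The pair of twin binary search trees of a word. -/
def baxterP {α : Type} [LinearOrder α] (w : List α) : BinaryTree α × BinaryTree α :=
  (sylvSharpTree w, sylvTree w)

/-- The word `w₁ ⋯ wₖ` is sent to `wₖ♯ ⋯ w₁♯`, where `♯` is the order-reversing permutation of the
alphabet `Fin n`. -/
def sharp {n : ℕ} (w : List (Fin n)) : List (Fin n) :=
  (w.map Fin.rev).reverse

/-! Helper facts: equality of `baxterP` is a congruence compatible with `sharp`. -/

/-- Mirror image of a tree, with the order of the labels reversed. -/
def mirror {n : ℕ} : BinaryTree (Fin n) → BinaryTree (Fin n)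
  | nil => nil
  | node x l r => node x.rev (mirror r) (mirror l)

theorem mirror_mirror {n : ℕ} (T : BinaryTree (Fin n)) : mirror (mirror T) = T := by
  induction T with
  | nil => rfl
  | node x l r hl hr => simp [mirror, hl, hr]

theorem mirror_insertRight {n : ℕ} (a : Fin n) (T : BinaryTree (Fin n)) :
    mirror (insertRight a T) = insertLeft a.rev (mirror T) := by
  induction T with
  | nil => rfl
  | node x l r hl hr =>
    by_cases h : x < a <;> simp [insertRight, insertLeft, mirror, h, hl, hr]

theorem sylvSharpTree_sharp {n : ℕ} (w : List (Fin n)) :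
    sylvSharpTree (sharp w) = mirror (sylvTree w) := by
  unfold sylvSharpTree sharp sylvTree
  rw [List.foldl_reverse]
  induction w with
  | nil => rfl
  | cons a w ih => simp [mirror_insertRight, ih]

theorem sharp_sharp {n : ℕ} (w : List (Fin n)) : sharp (sharp w) = w := by
  simp [sharp, Function.comp_def]

theorem sharp_append {n : ℕ} (u v : List (Fin n)) : sharp (u ++ v) = sharp v ++ sharp u := by
  simp [sharp]

theorem sylvTree_sharp {n : ℕ} (w : List (Fin n)) :
    sylvTree (sharp w) = mirror (sylvSharpTree w) := by
  rw [← mirror_mirror (sylvTree (sharp w)), ← sylvSharpTree_sharp, sharp_sharp]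

theorem baxterP_sharp {n : ℕ} {u v : List (Fin n)} (h : baxterP u = baxterP v) :
    baxterP (sharp u) = baxterP (sharp v) := by
  simp only [baxterP, Prod.mk.injEq] at h ⊢
  simp [sylvSharpTree_sharp, sylvTree_sharp, h.1, h.2]

/-- The part of a right strict binary search tree with labels `≤ y`. -/
def lower {α : Type} [LinearOrder α] (y : α) : BinaryTree α → BinaryTree α
  | nil => nil
  | node x l r => if x ≤ y then node x l (lower y r) else lower y l

/-- The part of a right strict binary search tree with labels `> y`. -/
def upper {α : Type} [LinearOrder α] (y : α) : BinaryTree α → BinaryTree α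
  | nil => nil
  | node x l r => if x ≤ y then upper y r else node x (upper y l) r

theorem lower_insertRight {α : Type} [LinearOrder α] (y a : α) (T : BinaryTree α) :
    lower y (insertRight a T) = if a ≤ y then insertRight a (lower y T) else lower y T := by
  induction T with
  | nil => by_cases h : a ≤ y <;> simp [insertRight, lower, h]
  | node x l r hl hr => simp only [insertRight, lower]; grind [insertRight, lower]

theorem upper_insertRight {α : Type} [LinearOrder α] (y a : α) (T : BinaryTree α) :
    upper y (insertRight a T) = if a ≤ y then upper y T else insertRight a (upper y T) := by
  induction T with
  | nil => by_cases h : a ≤ y <;> simp [insertRight, upper, h]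
  | node x l r hl hr => simp only [insertRight, upper]; grind [insertRight, upper]

theorem sylvTree_concat {α : Type} [LinearOrder α] (w : List α) (y : α) :
    sylvTree (w ++ [y]) = node y (lower y (sylvTree w)) (upper y (sylvTree w)) := by
  induction w with
  | nil => rfl
  | cons a w ih =>
    have h1 : sylvTree (a :: w ++ [y]) = insertRight a (sylvTree (w ++ [y])) := rfl
    have h2 : sylvTree (a :: w) = insertRight a (sylvTree w) := rfl
    rw [h1, h2, ih, lower_insertRight, upper_insertRight, insertRight]
    grind

theorem sylvTree_append {α : Type} [LinearOrder α] {u u' v v' : List α}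
    (hu : sylvTree u = sylvTree u') (hv : sylvTree v = sylvTree v') :
    sylvTree (u ++ v) = sylvTree (u' ++ v') := by
  have h1 : sylvTree (u ++ v) = sylvTree (u ++ v') := by
    unfold sylvTree at hv ⊢
    rw [List.foldr_append, List.foldr_append, hv]
  rw [h1]
  clear h1 hv
  induction v' using List.reverseRecOn with
  | nil => simpa using hu
  | append_singleton w y ih =>
    rw [← List.append_assoc, ← List.append_assoc, sylvTree_concat, sylvTree_concat, ih]

theorem sylvSharpTree_append {n : ℕ} {u u' v v' : List (Fin n)}
    (hu : sylvSharpTree u = sylvSharpTree u') (hv : sylvSharpTree v = sylvSharpTree v') :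
    sylvSharpTree (u ++ v) = sylvSharpTree (u' ++ v') := by
  have hu' : sylvTree (sharp u) = sylvTree (sharp u') := by simp only [sylvTree_sharp, hu]
  have hv' : sylvTree (sharp v) = sylvTree (sharp v') := by simp only [sylvTree_sharp, hv]
  have h := sylvTree_append hv' hu'
  rw [← sharp_append, ← sharp_append, sylvTree_sharp, sylvTree_sharp] at h
  rw [← mirror_mirror (sylvSharpTree (u ++ v)), h, mirror_mirror]

/-- The Baxter congruence on the words over the alphabet `Fin n`: two words are congruent if they
have the same pair of twin binary search trees. -/
def baxterCon (n : ℕ) : Con (FreeMonoid (Fin n)) where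
  r u v := baxterP u.toList = baxterP v.toList
  iseqv := ⟨fun _ => rfl, fun h => h.symm, fun h h' => h.trans h'⟩
  mul' := by
    intro u u' v v' hu hv
    simp only [baxterP, Prod.mk.injEq] at hu hv
    simp only [baxterP, Prod.mk.injEq, FreeMonoid.toList_mul]
    exact ⟨sylvSharpTree_append hu.1 hv.1, sylvTree_append hu.2 hv.2⟩

end Baxter

/-- The Baxter monoid of rank `n`, over the ordered alphabet `Fin n` (with `n` letters). -/
def BaxterMonoid (n : ℕ) : Type := (Baxter.baxterCon n).Quotient

namespace BaxterMonoid

instance (n : ℕ) : Monoid (BaxterMonoid n) :=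
  inferInstanceAs (Monoid (Baxter.baxterCon n).Quotient)

/-- The class of a word. -/
def mk {n : ℕ} (w : List (Fin n)) : BaxterMonoid n :=
  ((FreeMonoid.ofList w : FreeMonoid (Fin n)) : (Baxter.baxterCon n).Quotient)

/-- Schützenberger's involution, induced by `Baxter.sharp` on words. -/
instance (n : ℕ) : StarMul (BaxterMonoid n) where
  star := Quotient.lift (fun w : FreeMonoid (Fin n) => mk (Baxter.sharp w.toList))
    (fun _ _ h => (Con.eq _).2 (Baxter.baxterP_sharp h))
  star_involutive x := by
    induction x using Quotient.inductionOn with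
    | h w => exact congrArg mk (Baxter.sharp_sharp w.toList)
  star_mul x y := by
    induction x using Quotient.inductionOn with
    | h u =>
      induction y using Quotient.inductionOn with
      | h v => exact congrArg mk (Baxter.sharp_append u.toList v.toList)

/-- The involution monoid `(baxt_n, ♯)`. -/
def withInvolution (n : ℕ) : InvolutionSemigroup where
  carrier := BaxterMonoid n
  nonempty := ⟨1⟩

end BaxterMonoid

/-! It suffices to place `baxt_n` in every variety containing `baxt_k`, for `k ≥ 4`. Substitutions
compatible with the involution map the free monoid on `n` letters to `baxt_k`, and words with equal
images under all of them are Baxter congruent. These maps need not factor through `baxt_n`: by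
`IsVariety.mem_of_separating` it is enough that their joint image, inside a power of `baxt_k`, maps
onto `baxt_n`.

The separating invariants count the letters `c` to the right of all smaller letters from a set `P`.
They determine the right strict tree (`sylvTree_eq_of_tailCount`) by recursion on its root, the last
letter. Sending `c` to `1` and its blockers to `0` makes such a count visible on the left spine of a
tree of rank `k` (`tailCount_one_eq`). Compatibility with the involution forces extra letters `rev
1` and `rev 0`; for `k ≥ 4` both exceed `1` and disturb nothing (`tailCount_flatMap_symSubst`). The
left strict tree follows by applying `sharp`. -/

/-! ### A criterion for membership in a variety -/

namespace InvolutionSemigroup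

/-- The semigroup structure on the image of a homomorphism. -/
abbrev rangeSemigroup {F S : InvolutionSemigroup} {f : F.carrier → S.carrier}
    (hf : IsHom F S f) : Semigroup (Set.range f) where
  mul x y := ⟨x.1 * y.1, by
    obtain ⟨_, a, rfl⟩ := x
    obtain ⟨_, b, rfl⟩ := y
    exact ⟨a * b, hf.1 a b⟩⟩
  mul_assoc x y z := Subtype.ext (mul_assoc x.1 y.1 z.1)

/-- The involution semigroup formed by the image of a homomorphism. -/
def range {F S : InvolutionSemigroup} {f : F.carrier → S.carrier} (hf : IsHom F S f) :
    InvolutionSemigroup where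
  carrier := Set.range f
  nonempty := F.nonempty.map fun x => ⟨f x, x, rfl⟩
  semigroup := rangeSemigroup hf
  starMul :=
    letI := rangeSemigroup hf
    { star := fun x => ⟨star x.1, by
        obtain ⟨_, a, rfl⟩ := x
        exact ⟨star a, hf.2 a⟩⟩
      star_involutive := fun x => Subtype.ext (star_star x.1)
      star_mul := fun x y => Subtype.ext (star_mul x.1 y.1) }

/-- If the homomorphisms from `F` to `S` separate the points of `F` that are separated by a
surjective homomorphism from `F` to `T`, then `T` lies in every variety that contains `S`. -/
theorem IsVariety.mem_of_separating {V : Set InvolutionSemigroup} (hV : IsVariety V)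
    {F S T : InvolutionSemigroup} (hS : S ∈ V) {ι : Type} (φ : ι → F.carrier → S.carrier)
    (hφ : ∀ i, IsHom F S (φ i)) (π : F.carrier → T.carrier) (hπ : IsHom F T π)
    (hsurj : Function.Surjective π) (hsep : ∀ x y, (∀ i, φ i x = φ i y) → π x = π y) : T ∈ V := by
  have hΦ : IsHom F (prod fun _ : ι => S) (fun x i => φ i x) :=
    ⟨fun x y => funext fun i => (hφ i).1 x y, fun x => funext fun i => (hφ i).2 x⟩
  have hR : range hΦ ∈ V := hV.of_injective _ (hV.prod_mem ι _ fun _ => hS) (range hΦ) Subtype.val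
    ⟨fun _ _ => rfl, fun _ => rfl⟩ Subtype.val_injective
  let g : (range hΦ).carrier → T.carrier := fun x => π x.2.choose
  -- The chosen preimage is irrelevant: two preimages agree under every `φ i`, hence under `π`.
  have hg : ∀ (x : F.carrier) (z : (range hΦ).carrier), z.1 = (fun i => φ i x) → g z = π x :=
    fun x z hz => hsep _ _ fun i => congrFun (z.2.choose_spec.trans hz) i
  refine hV.of_surjective _ hR T g ⟨?_, ?_⟩ ?_
  · rintro ⟨_, a, rfl⟩ ⟨_, b, rfl⟩
    rw [hg a ⟨_, a, rfl⟩ rfl, hg b ⟨_, b, rfl⟩ rfl, ← hπ.1]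
    exact hg (a * b) _ (hΦ.1 a b).symm
  · rintro ⟨_, a, rfl⟩
    rw [hg a ⟨_, a, rfl⟩ rfl, ← hπ.2]
    exact hg (star a) _ (hΦ.2 a).symm
  · intro t
    obtain ⟨x, rfl⟩ := hsurj t
    exact ⟨⟨_, x, rfl⟩, hg x _ rfl⟩

end InvolutionSemigroup

namespace Baxter

open BinaryTree

/-! ### Counting the occurrences of a letter after the last blocking letter -/

section TailCount

variable {α : Type} [LinearOrder α]

/-- The number of occurrences of `c` in `w` to the right of all letters `b < c` satisfying `P`. -/
def tailCount (P : α → Bool) (c : α) : List α → ℕ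
  | [] => 0
  | a :: w => tailCount P c w + if a = c ∧ ∀ b ∈ w, P b → c ≤ b then 1 else 0

theorem tailCount_concat (P : α → Bool) (c y : α) (w : List α) :
    tailCount P c (w ++ [y]) =
      if y = c then tailCount P c w + 1 else if P y ∧ y < c then 0 else tailCount P c w := by
  induction w with
  | nil => simp [tailCount]
  | cons a w ih =>
    rw [List.cons_append, tailCount, ih, tailCount]
    grind

/-- Deleting letters only shrinks the set of blockers, so letting `P` vary makes the family of
counts stable under passing to subtrees. -/
theorem tailCount_filter (P Q : α → Bool) (c : α) (w : List α) :
    tailCount P c (w.filter Q) = if Q c then tailCount (fun b => P b && Q b) c w else 0 := by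
  induction w with
  | nil => simp [tailCount]
  | cons a w ih =>
    rw [List.filter_cons]
    by_cases ha : Q a <;> simp only [ha, if_true, Bool.false_eq_true, if_false, tailCount,
      List.mem_filter, ih] <;> grind

theorem sylvTree_filter_le (y : α) (w : List α) :
    sylvTree (w.filter (· ≤ y)) = lower y (sylvTree w) := by
  induction w with
  | nil => rfl
  | cons a w ih =>
    have h : sylvTree (a :: w) = insertRight a (sylvTree w) := rfl
    rw [h, lower_insertRight, ← ih, List.filter_cons]
    by_cases ha : a ≤ y <;> simp [ha, sylvTree]

theorem sylvTree_filter_lt (y : α) (w : List α) :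
    sylvTree (w.filter (y < ·)) = upper y (sylvTree w) := by
  induction w with
  | nil => rfl
  | cons a w ih =>
    have h : sylvTree (a :: w) = insertRight a (sylvTree w) := rfl
    rw [h, upper_insertRight, ← ih, List.filter_cons]
    by_cases ha : a ≤ y <;> simp [ha, sylvTree, ← not_le]

/-- The numbers `tailCount P c w` determine the right strict binary search tree of `w`. -/
theorem sylvTree_eq_of_tailCount (u v : List α)
    (h : ∀ P c, tailCount P c u = tailCount P c v) : sylvTree u = sylvTree v := by
  induction hk : u.length using Nat.strong_induction_on generalizing u v with
  | _ k ih =>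
    rcases List.eq_nil_or_concat u with rfl | ⟨u, y, rfl⟩ <;>
      rcases List.eq_nil_or_concat v with rfl | ⟨v, z, rfl⟩
    · rfl
    · simpa [tailCount, tailCount_concat] using h (fun _ => true) z
    · simpa [tailCount, tailCount_concat] using h (fun _ => true) y
    simp only [List.concat_eq_append, tailCount_concat] at h hk ⊢
    obtain rfl : y = z := by
      -- If the last letters differed, the larger would have a positive count in its own word and
      -- count `0` in the other, where the smaller one blocks it.
      have h1 := h (fun _ => true) y
      have h2 := h (fun _ => true) z
      grind
    rw [sylvTree_concat, sylvTree_concat, ← sylvTree_filter_le, ← sylvTree_filter_le,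
      ← sylvTree_filter_lt, ← sylvTree_filter_lt]
    have hlen : ∀ Q : α → Bool, (u.filter Q).length < k := fun Q => by
      have := List.length_filter_le Q u
      simp only [List.length_append, List.length_singleton] at hk
      omega
    congr 1
    · refine ih _ (hlen _) _ _ (fun P c => ?_) rfl
      -- The final `y` blocks no `c ≤ y`, and for `c = y` it adds one on both sides.
      have := h (fun b => P b && decide (b ≤ y)) c
      rw [tailCount_filter, tailCount_filter]
      grind
    · refine ih _ (hlen _) _ _ (fun P c => ?_) rfl
      -- Here the final `y` is not among the blockers.
      have := h (fun b => P b && decide (y < b)) c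
      rw [tailCount_filter, tailCount_filter]
      grind

end TailCount

/-! ### Recovering a tail count from the tree -/

section Spine

variable {k : ℕ} [NeZero k]

/-- The label `0` occurs on the left spine. -/
def zeroOnSpine : BinaryTree (Fin k) → Prop
  | nil => False
  | node x l _ => x = 0 ∨ zeroOnSpine l

open Classical in
/-- The number of labels `1` on the left spine above the first label `0`. -/
noncomputable def spineOnes : BinaryTree (Fin k) → ℕ
  | nil => 0
  | node x l _ => if x = 0 then 0 else (if x = 1 then 1 else 0) + spineOnes l

theorem zeroOnSpine_insertRight (a : Fin k) (T : BinaryTree (Fin k)) :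
    zeroOnSpine (insertRight a T) ↔ a = 0 ∨ zeroOnSpine T := by
  induction T with
  | nil => simp [insertRight, zeroOnSpine]
  | node x l r hl hr =>
    rw [insertRight]
    split_ifs with h
    · have : a ≠ 0 := (Fin.pos_iff_ne_zero).1 (lt_of_le_of_lt (Fin.zero_le x) h)
      simp [zeroOnSpine, this]
    · simp only [zeroOnSpine, hl]
      tauto

-- A new `1` moves left past every label `≥ 1`, so it ends on the spine unless it meets a `0`, which
-- diverts it to the right.
open Classical in
theorem spineOnes_insertRight (hk : 2 ≤ k) (a : Fin k) (T : BinaryTree (Fin k)) :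
    spineOnes (insertRight a T) = spineOnes T + if a = 1 ∧ ¬ zeroOnSpine T then 1 else 0 := by
  have h1 : ((1 : Fin k) : ℕ) = 1 := by
    rw [Fin.val_one', Nat.mod_eq_of_lt hk]
  have h0 : ((0 : Fin k) : ℕ) = 0 := rfl
  induction T with
  | nil =>
    have : (1 : Fin k) ≠ 0 := fun h => by
      rw [Fin.ext_iff, h1, h0] at h
      omega
    by_cases h : a = 1 <;> simp [insertRight, spineOnes, zeroOnSpine, h, this]
  | node x l r hl hr =>
    rw [insertRight]
    split_ifs with h h' h'
    · obtain ⟨rfl, h'⟩ := h'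
      have : x = 0 := by rw [Fin.lt_def] at h; rw [Fin.ext_iff]; omega
      simp [zeroOnSpine, this] at h'
    · simp [spineOnes]
    · simp only [zeroOnSpine, not_or] at h'
      simp only [spineOnes, hl, if_neg h'.2.1, if_pos (And.intro h'.1 h'.2.2)]
      omega
    · simp only [zeroOnSpine, not_or] at h'
      simp only [spineOnes, hl]
      split_ifs <;> tauto

theorem tailCount_one_eq (hk : 2 ≤ k) (w : List (Fin k)) :
    tailCount (fun _ => true) 1 w = spineOnes (sylvTree w) := by
  have hz : ∀ w : List (Fin k), zeroOnSpine (sylvTree w) ↔ 0 ∈ w := by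
    intro w
    induction w with
    | nil => simp [sylvTree, zeroOnSpine]
    | cons a w ih =>
      have h : sylvTree (a :: w) = insertRight a (sylvTree w) := rfl
      rw [h, zeroOnSpine_insertRight, ih, List.mem_cons, eq_comm]
  have h1 : ((1 : Fin k) : ℕ) = 1 := by
    rw [Fin.val_one', Nat.mod_eq_of_lt hk]
  induction w with
  | nil => rfl
  | cons a w ih =>
    have h : sylvTree (a :: w) = insertRight a (sylvTree w) := rfl
    have hle : (∀ b ∈ w, (1 : Fin k) ≤ b) ↔ 0 ∉ w := by
      refine ⟨fun h h0 => ?_, fun h b hb => ?_⟩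
      · have := Fin.le_def.1 (h 0 h0)
        rw [h1, Fin.val_zero] at this
        omega
      · have : b ≠ 0 := fun hb0 => h (hb0 ▸ hb)
        rw [Fin.le_def, h1]
        exact Nat.one_le_iff_ne_zero.2 fun hb0 => this (Fin.ext hb0)
    rw [h, spineOnes_insertRight hk, hz, tailCount, ih]
    simp [hle]

end Spine

/-! ### Substitutions compatible with the involution -/

section Substitution

variable {n k : ℕ}

theorem sharp_flatMap (f : Fin n → List (Fin k)) (hf : ∀ i, f i.rev = sharp (f i))
    (w : List (Fin n)) : (sharp w).flatMap f = sharp (w.flatMap f) := by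
  induction w with
  | nil => rfl
  | cons a w ih =>
    have h : sharp (a :: w) = sharp w ++ [a.rev] := by simp [sharp]
    rw [h, List.flatMap_append, ih, List.flatMap_cons (xs := w), sharp_append]
    simp [hf]

variable [NeZero k]

/-- The substitution that sends `c` to `1` and the letters `i < c` satisfying `P` to `0`, made
symmetric with respect to the involution. -/
def symSubst (k : ℕ) [NeZero k] (P : Fin n → Bool) (c i : Fin n) : List (Fin k) :=
  (if P i ∧ i < c then [0] else []) ++ (if i = c then [1] else []) ++
    ((if i.rev = c then [Fin.rev 1] else []) ++
      if P i.rev ∧ i.rev < c then [Fin.rev 0] else [])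

theorem symSubst_rev (P : Fin n → Bool) (c i : Fin n) :
    symSubst k P c i.rev = sharp (symSubst k P c i) := by
  simp only [symSubst, sharp_append, Fin.rev_rev]
  congr 2 <;> split_ifs <;> simp [sharp]

theorem tailCount_flatMap_symSubst (hk : 4 ≤ k) (P : Fin n → Bool) (c : Fin n)
    (w : List (Fin n)) :
    tailCount (fun _ => true) 1 (w.flatMap (symSubst k P c)) = tailCount P c w := by
  have h1 : ((1 : Fin k) : ℕ) = 1 := by
    rw [Fin.val_one', Nat.mod_eq_of_lt (by omega)]
  have h01 : ¬ (1 : Fin k) ≤ 0 := by rw [Fin.le_def, h1, Fin.val_zero]; omega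
  -- This is `1 < k - 2`, the place where `k ≥ 4` is needed.
  have hr1 : (1 : Fin k) < Fin.rev 1 := by rw [Fin.lt_def, Fin.val_rev, h1]; omega
  have hr0 : (1 : Fin k) < Fin.rev 0 := by rw [Fin.lt_def, Fin.val_rev, h1, Fin.val_zero]; omega
  have hmem : ∀ w : List (Fin n), (∀ b ∈ w.flatMap (symSubst k P c), (1 : Fin k) ≤ b) ↔
      ∀ b ∈ w, P b → c ≤ b := by
    intro w
    simp only [List.mem_flatMap, symSubst, List.mem_append]
    refine ⟨fun h b hb hP => ?_, ?_⟩
    · by_contra hc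
      exact h01 (h 0 ⟨b, hb, Or.inl (Or.inl (by simp [hP, not_le.1 hc]))⟩)
    · rintro h b ⟨i, hi, (hb | hb) | (hb | hb)⟩ <;> split_ifs at hb with hc <;>
        simp only [List.mem_singleton, List.not_mem_nil] at hb
      · exact absurd (h i hi hc.1) (not_le.2 hc.2)
      · exact hb.ge
      · exact hb ▸ hr1.le
      · exact hb ▸ hr0.le
  induction w with
  | nil => rfl
  | cons a w ih =>
    have hskip : ∀ (b : Fin k) (p : Prop) [Decidable p] (v : List (Fin k)), b ≠ 1 →
        tailCount (fun _ => true) 1 ((if p then [b] else []) ++ v) =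
          tailCount (fun _ => true) 1 v := by
      intro b p _ v hb
      split_ifs <;> simp [tailCount, hb]
    rw [List.flatMap_cons, tailCount, ← ih, symSubst, List.append_assoc, List.append_assoc,
      hskip _ _ _ (fun h => h01 h.ge)]
    by_cases ha : a = c
    · subst ha
      -- Letters following `1` within the same block come from the mirrored half and cannot block
      -- it.
      have hb : (∀ b ∈ (if a.rev = a then [Fin.rev (1 : Fin k)] else []) ++
          (if P a.rev ∧ a.rev < a then [Fin.rev 0] else []), (1 : Fin k) ≤ b) := by
        intro b hb
        rcases List.mem_append.1 hb with hb | hb <;> split_ifs at hb <;>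
          simp only [List.mem_singleton, List.not_mem_nil] at hb
        · exact hb ▸ hr1.le
        · exact hb ▸ hr0.le
      rw [if_pos rfl, List.singleton_append, tailCount, List.append_assoc,
        hskip _ _ _ hr1.ne', hskip _ _ _ hr0.ne', ← List.append_assoc]
      congr 1
      simp only [List.forall_mem_append.trans (and_iff_right hb), forall_const, hmem, true_and]
    · rw [if_neg ha, List.nil_append, List.append_assoc, hskip _ _ _ hr1.ne',
        hskip _ _ _ hr0.ne', if_neg (fun h => ha h.1), add_zero]

/-- The symmetric substitutions separate words that are not Baxter congruent. -/
theorem baxterP_eq_of_symSubst (hk : 4 ≤ k) {u v : List (Fin n)}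
    (h : ∀ P c, baxterP (u.flatMap (symSubst k P c)) = baxterP (v.flatMap (symSubst k P c))) :
    baxterP u = baxterP v := by
  have key : ∀ u v : List (Fin n),
      (∀ P c, baxterP (u.flatMap (symSubst k P c)) = baxterP (v.flatMap (symSubst k P c))) →
      sylvTree u = sylvTree v := by
    intro u v h
    refine sylvTree_eq_of_tailCount u v fun P c => ?_
    rw [← tailCount_flatMap_symSubst hk P c u, ← tailCount_flatMap_symSubst hk P c v,
      tailCount_one_eq (by omega), tailCount_one_eq (by omega)]
    exact congrArg (fun T => spineOnes T.2) (h P c)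
  have hs : sylvTree (sharp u) = sylvTree (sharp v) := key _ _ fun P c => by
    rw [sharp_flatMap _ (symSubst_rev P c), sharp_flatMap _ (symSubst_rev P c)]
    exact baxterP_sharp (h P c)
  rw [sylvTree_sharp, sylvTree_sharp] at hs
  refine Prod.ext ?_ (key u v h)
  change sylvSharpTree u = sylvSharpTree v
  rw [← mirror_mirror (sylvSharpTree u), hs, mirror_mirror]

end Substitution

/-- The free monoid on `Fin n` with the involution `sharp`. -/
def freeWithSharp (n : ℕ) : InvolutionSemigroup where
  carrier := FreeMonoid (Fin n)
  nonempty := ⟨1⟩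
  semigroup := inferInstance
  starMul :=
    { star := fun w => FreeMonoid.ofList (sharp w.toList)
      star_involutive := fun w => sharp_sharp w.toList
      star_mul := fun u v => sharp_append u.toList v.toList }

end Baxter

namespace BaxterMonoid

open Baxter InvolutionSemigroup

theorem mk_eq_mk {n : ℕ} {u v : List (Fin n)} : mk u = mk v ↔ baxterP u = baxterP v :=
  Con.eq (baxterCon n)

theorem withInvolution_mem {V : Set InvolutionSemigroup} (hV : IsVariety V) {k : ℕ} (hk : 4 ≤ k)
    (h : withInvolution k ∈ V) (n : ℕ) : withInvolution n ∈ V := by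
  have : NeZero k := ⟨by omega⟩
  refine hV.mem_of_separating (F := freeWithSharp n) h (ι := (Fin n → Bool) × Fin n)
    (fun i w => mk (List.flatMap (symSubst k i.1 i.2) (FreeMonoid.toList w)))
    (fun i => ⟨fun u v => ?_, fun u => ?_⟩) (fun w => mk (FreeMonoid.toList w))
    ⟨fun _ _ => rfl, fun _ => rfl⟩ (fun t => ?_) (fun u v huv => ?_)
  · exact congrArg mk (List.flatMap_append (xs := FreeMonoid.toList u))
  · exact congrArg mk (sharp_flatMap _ (symSubst_rev i.1 i.2) (FreeMonoid.toList u))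
  · induction t using Quotient.inductionOn with
    | h w => exact ⟨w, rfl⟩
  · exact mk_eq_mk.2 (baxterP_eq_of_symSubst hk fun P c => mk_eq_mk.1 (huv (P, c)))

theorem var_subset {m n : ℕ} (hn : 4 ≤ n) :
    (withInvolution m).var ⊆ (withInvolution n).var :=
  Set.sInter_subset_sInter fun _ hV => ⟨hV.1, withInvolution_mem hV.1 hn hV.2 m⟩

end BaxterMonoid

theorem mainTheorem10 (m n : ℕ) (hm : 4 ≤ m) (hn : 4 ≤ n) :
    (BaxterMonoid.withInvolution m).var = (BaxterMonoid.withInvolution n).var :=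
  (BaxterMonoid.var_subset hn).antisymm (BaxterMonoid.var_subset hm)
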